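/- Let $A$ and $B$ be finitely generated groups with generating sets $X$ and $Y$ respectively, let $n\ge 1$, and let $$G_n=A(n)B=(A*B)\,/\,\bigl([A,B]\cap\gamma_{n+1}(A*B)\bigr)$$ be their $n$-th nilpotent product, where $[A,B]$ is the subgroup of the free product $A*B$ generated by the commutators of elements of $A$ with elements of $B$, and $\gamma_1(G)=G$, $\gamma_{k+1}(G)=[\gamma_k(G),G]$. Identify $A$, $B$ with their images in $G_n$, and let $C_A(B)$ (respectively $C_B(A)$) be the normal subgroup of those elements of $A$ (of $B$) that commute in $G_n$ with every element of $B$ (of $A$). For a group $G$ generated by a set $S$, a palindrome is an element of $G$ represented by a word in the alphabet $S\cup S^{-1}$ that reads the same forwards and backwards; the palindromic length of $g\in G$ is the least $k\ge 0$ such that $g$ is a product of $k$ palindromes; and $\mathrm{pw}(G,S)\in\mathbb{N}\cup\{\infty\}$ is the supremum of the palindromic lengths of the elements of $G$. (i) For any generating sets $\overline X$ of $A/C_A(B)$ and $\overline Y$ of $B/C_B(A)$ (in particular for the images of $X$ and $Y$), with $m_A=|\overline X|$ and $m_B=|\overline Y|$ in $\mathbb{N}\cup\{\infty\}$, $$\max\{\mathrm{pw}(A,X),\mathrm{pw}(B,Y)\}\le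 \mathrm{pw}(G_n,X\cup Y)\le \mathrm{pw}(A,X)+\mathrm{pw}(B,Y)+3(m_A+m_B).$$ (ii) If $A=C_A(B)$ or $B=C_B(A)$, then $G_n$ is the direct product, that is, the canonical homomorphism $G_n\to A\times B$ is an isomorphism, and $$\max\{\mathrm{pw}(A,X),\mathrm{pw}(B,Y)\}\le \mathrm{pw}(G_n,X\cup Y)\le \mathrm{pw}(A,X)+\mathrm{pw}(B,Y).$$ -/

import Mathlib

universe u v

section Palindromes

variable {G : Type u} [Group G]

/-- `g` is a palindrome with respect to `X`: it is the value of a word `a₁ a₂ ⋯ aₖ` in the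
alphabet `X ∪ X⁻¹` (possibly the empty word) that reads the same forwards and backwards. -/
def IsPalindrome (X : Set G) (g : G) : Prop :=
  ∃ w : List G, (∀ a ∈ w, a ∈ X ∨ a⁻¹ ∈ X) ∧ w.reverse = w ∧ w.prod = g

/-- The palindromic length of `g`: the minimal number `k` such that `g` is a product of `k`
palindromes with respect to `X` (it is `⊤` if there is no such `k`, and `1` has length `0`). -/
noncomputable def palLength (X : Set G) (g : G) : ℕ∞ :=
  ⨅ (l : List G) (_ : (∀ p ∈ l, IsPalindrome X p) ∧ l.prod = g), (l.length : ℕ∞)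

/-- The palindromic width `pw(G, X)`: the supremum of the palindromic lengths. -/
noncomputable def pw (X : Set G) : ℕ∞ :=
  ⨆ g : G, palLength X g

end Palindromes

section NilpotentProduct

open scoped commutatorElement

variable (A : Type u) (B : Type v) [Group A] [Group B] (n : ℕ)

/-- The Cartesian subgroup `[A, B]` of the free product `A ∗ B`: the subgroup generated by the
commutators `[a, b]` with `a ∈ A` and `b ∈ B`. -/
def cartesianSubgroup : Subgroup (Monoid.Coprod A B) :=
  ⁅(Monoid.Coprod.inl : A →* Monoid.Coprod A B).range,
    (Monoid.Coprod.inr : B →* Monoid.Coprod A B).range⁆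

/-- `[A, B] ∩ γₙ₊₁(A ∗ B)`. Mathlib numbers the lower central series from `0`, so that
`(⊤ : Subgroup G).lowerCentralSeries n` is `γₙ₊₁(G)`. -/
def nilpotentProductKernel : Subgroup (Monoid.Coprod A B) :=
  cartesianSubgroup A B ⊓ (⊤ : Subgroup (Monoid.Coprod A B)).lowerCentralSeries n

instance cartesianSubgroup_normal : (cartesianSubgroup A B).Normal := by
  rw [← Subgroup.normalizer_eq_top_iff, eq_top_iff, ← Monoid.Coprod.range_inl_sup_range_inr]
  exact sup_le (Subgroup.normalizer_commutator_ge_left _ _)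
    (Subgroup.normalizer_commutator_ge_right _ _)

instance nilpotentProductKernel_normal : (nilpotentProductKernel A B n).Normal := by
  unfold nilpotentProductKernel
  infer_instance

theorem cartesianSubgroup_le_ker :
    cartesianSubgroup A B ≤ (Monoid.Coprod.toProd : Monoid.Coprod A B →* A × B).ker := by
  rw [cartesianSubgroup, Subgroup.commutator_le]
  rintro _ ⟨a, rfl⟩ _ ⟨b, rfl⟩
  simp [MonoidHom.mem_ker, commutatorElement_def, Prod.ext_iff]

theorem map_mem_nilpotentProductKernel (f : A →* A) (g : B →* B) {x : Monoid.Coprod A B}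
    (hx : x ∈ nilpotentProductKernel A B n) :
    Monoid.Coprod.map f g x ∈ nilpotentProductKernel A B n := by
  refine ⟨?_, ?_⟩
  · have h : (cartesianSubgroup A B).map (Monoid.Coprod.map f g) ≤ cartesianSubgroup A B := by
      rw [cartesianSubgroup, Subgroup.map_commutator]
      refine Subgroup.commutator_mono ?_ ?_
      · rintro _ ⟨_, ⟨a, rfl⟩, rfl⟩
        exact ⟨f a, by simp⟩
      · rintro _ ⟨_, ⟨b, rfl⟩, rfl⟩
        exact ⟨g b, by simp⟩
    exact h ⟨x, hx.1, rfl⟩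
  · have h : Monoid.Coprod.map f g x ∈
        ((⊤ : Subgroup (Monoid.Coprod A B)).lowerCentralSeries n).map (Monoid.Coprod.map f g) :=
      ⟨x, hx.2, rfl⟩
    rw [Subgroup.map_lowerCentralSeries] at h
    exact Subgroup.lowerCentralSeries_mono n le_top h

/-- The `n`-th nilpotent product `A(n)B = (A ∗ B) / ([A, B] ∩ γₙ₊₁(A ∗ B))`. -/
abbrev NilpotentProduct : Type (max u v) :=
  Monoid.Coprod A B ⧸ nilpotentProductKernel A B n

namespace NilpotentProduct

/-- The canonical homomorphism `A → A(n)B`. -/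
def inl : A →* NilpotentProduct A B n :=
  (QuotientGroup.mk' (nilpotentProductKernel A B n)).comp Monoid.Coprod.inl

/-- The canonical homomorphism `B → A(n)B`. -/
def inr : B →* NilpotentProduct A B n :=
  (QuotientGroup.mk' (nilpotentProductKernel A B n)).comp Monoid.Coprod.inr

/-- The canonical homomorphism `A(n)B → A × B`. -/
def toProd : NilpotentProduct A B n →* A × B :=
  QuotientGroup.lift (nilpotentProductKernel A B n) Monoid.Coprod.toProd
    (inf_le_left.trans (cartesianSubgroup_le_ker A B))

/-- `C_A(B)`: the subgroup of those `a ∈ A` that commute in `A(n)B` with every element of `B`. -/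
def centralizerLeft : Subgroup A :=
  (Subgroup.centralizer ((inr A B n).range : Set (NilpotentProduct A B n))).comap (inl A B n)

/-- `C_B(A)`: the subgroup of those `b ∈ B` that commute in `A(n)B` with every element of `A`. -/
def centralizerRight : Subgroup B :=
  (Subgroup.centralizer ((inl A B n).range : Set (NilpotentProduct A B n))).comap (inr A B n)

theorem mem_centralizerLeft (a : A) : a ∈ centralizerLeft A B n ↔ ∀ b : B,
    ⁅(Monoid.Coprod.inl a : Monoid.Coprod A B), Monoid.Coprod.inr b⁆ ∈
      nilpotentProductKernel A B n := by
  simp only [← QuotientGroup.eq_one_iff]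
  change (∀ y ∈ Set.range (inr A B n), y * inl A B n a = inl A B n a * y) ↔
    ∀ b : B, ⁅inl A B n a, inr A B n b⁆ = 1
  simp only [Set.forall_mem_range, commutatorElement_eq_one_iff_mul_comm]
  exact forall_congr' fun b => eq_comm

theorem mem_centralizerRight (b : B) : b ∈ centralizerRight A B n ↔ ∀ a : A,
    ⁅(Monoid.Coprod.inl a : Monoid.Coprod A B), Monoid.Coprod.inr b⁆ ∈
      nilpotentProductKernel A B n := by
  simp only [← QuotientGroup.eq_one_iff]
  change (∀ y ∈ Set.range (inl A B n), y * inr A B n b = inr A B n b * y) ↔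
    ∀ a : A, ⁅inl A B n a, inr A B n b⁆ = 1
  simp only [Set.forall_mem_range, commutatorElement_eq_one_iff_mul_comm]

instance centralizerLeft_normal : (centralizerLeft A B n).Normal := by
  refine ⟨fun c hc a => ?_⟩
  rw [mem_centralizerLeft] at hc ⊢
  intro b
  simpa [map_commutatorElement] using map_mem_nilpotentProductKernel A B n
    (MulAut.conj a).toMonoidHom (MonoidHom.id B) (hc b)

instance centralizerRight_normal : (centralizerRight A B n).Normal := by
  refine ⟨fun c hc b => ?_⟩
  rw [mem_centralizerRight] at hc ⊢
  intro a
  simpa [map_commutatorElement] using map_mem_nilpotentProductKernel A B n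
    (MonoidHom.id A) (MulAut.conj b).toMonoidHom (hc a)

end NilpotentProduct

end NilpotentProduct

/-!
The lower bound holds because the projections of `A(n)B` onto `A` and `B` send generators to
generators or to `1`, hence palindromes to palindromes.

For the upper bound, write an element of `G = A(n)B` as `a b c` with `a ∈ A`, `b ∈ B` and `c` in the
image `D` of `[A, B]`. If `C_A(B) = A` or `C_B(A) = B`, then `D` is trivial. In general it has to be
shown that `c` is a product of `3 (m_A + m_B)` palindromes. A commutator `[u, x]` with a palindrome
`x` is the product of the palindromes `u x u'`, `u'⁻¹ u⁻¹` and `x⁻¹`, where `u'` is the reversal of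
a word for `u` (`palLength_commutator_le`). So it is enough to write `c` as a product of
`m_A + m_B` such commutators, and two facts give this.

* The quotient of `A` by `C_A(B)` and commutators is an abelian group generated by `m_A` elements.
  An exchange argument replaces these one at a time by elements `y²` or `s y²` with `s` in the image
  of `X`; these are images of palindromes, so `A` is generated by `m_A` palindromes modulo `C_A(B)`
  and commutators (`exists_palindromes_generating`). The same holds for `B`.
* The series `D, [D, G], [[D, G], G], …` reaches `1` after `n - 1` steps, since `D` meets
  `γₙ₊₁(G)` trivially in the image of the free product. In each step the relevant commutator map is
  multiplicative in both variables and it kills commutators and the subgroups `C_A(B)`, `C_B(A)`.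
  Hence only commutators with the palindromic generators are needed
  (`commutator_subset_commutatorProducts`). As `[u d, x] = [d, x] [u, x]` for central `[d, x]`, the
  contribution of each step is absorbed without increasing the number of commutators
  (`mem_commutatorProducts_of_commutatorSeries_eq_bot`).
-/

open scoped commutatorElement

/-! ### Palindromes and palindromic length -/

section PalindromeLemmas

variable {G : Type u} [Group G] {H : Type v} [Group H]

theorem IsPalindrome.one (S : Set G) : IsPalindrome S 1 :=
  ⟨[], by simp, rfl, rfl⟩

theorem IsPalindrome.of_mem {S : Set G} {s : G} (hs : s ∈ S) : IsPalindrome S s :=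
  ⟨[s], by simpa using Or.inl hs, rfl, by simp⟩

theorem IsPalindrome.inv {S : Set G} {g : G} (hg : IsPalindrome S g) : IsPalindrome S g⁻¹ := by
  obtain ⟨w, hw, hrev, rfl⟩ := hg
  refine ⟨w.map (·⁻¹), ?_, ?_, ?_⟩
  · simp only [List.mem_map]
    rintro _ ⟨a, ha, rfl⟩
    simpa using (hw a ha).symm
  · rw [← List.map_reverse, hrev]
  · rw [List.prod_inv_reverse, ← List.map_reverse, hrev]

theorem IsPalindrome.letter_mul_mul {S : Set G} {a g : G} (ha : a ∈ S ∨ a⁻¹ ∈ S)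
    (hg : IsPalindrome S g) : IsPalindrome S (a * g * a) := by
  obtain ⟨w, hw, hrev, rfl⟩ := hg
  refine ⟨a :: w ++ [a], ?_, by simp [hrev], by simp [mul_assoc]⟩
  intro b hb
  simp only [List.cons_append, List.mem_cons, List.mem_append, List.not_mem_nil, or_false] at hb
  rcases hb with rfl | hb | rfl
  exacts [ha, hw b hb, ha]

/-- A homomorphism that sends every generator to a generator or to `1` preserves palindromes:
the letters that become trivial are deleted from the word. -/
theorem IsPalindrome.map {S : Set G} {T : Set H} (f : G →* H)
    (hf : ∀ s ∈ S, f s ∈ T ∨ f s = 1) {g : G} (hg : IsPalindrome S g) :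
    IsPalindrome T (f g) := by
  classical
  obtain ⟨w, hw, hrev, rfl⟩ := hg
  refine ⟨(w.map f).filter (· ≠ 1), ?_, ?_, ?_⟩
  · intro b hb
    simp only [List.mem_filter, List.mem_map, decide_eq_true_eq] at hb
    obtain ⟨⟨a, ha, rfl⟩, hne⟩ := hb
    rcases hw a ha with h | h
    · exact Or.inl ((hf a h).resolve_right hne)
    · refine Or.inr ?_
      have := (hf _ h).resolve_right (by simpa using hne)
      simpa using this
  · rw [← List.filter_reverse, ← List.map_reverse, hrev]
  · rw [map_list_prod]
    clear hw hrev
    induction w with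
    | nil => rfl
    | cons a w ih =>
      by_cases h : f a = 1
      · simpa [h] using ih
      · simpa [h] using ih

/-- Every element `g` of a group generated by `S` has a reversal `g'`, obtained by reading a word
for `g` backwards. Flanking a palindrome by `g` and `g'` gives a palindrome, and so does flanking
it by `g⁻¹` and `g'⁻¹`. The reversal depends on the word chosen, but not modulo commutators. -/
theorem exists_reversal {S : Set G} (hS : Subgroup.closure S = ⊤) (g : G) :
    ∃ g' : G, Abelianization.of g' = Abelianization.of g ∧ ∀ x, IsPalindrome S x →
      IsPalindrome S (g * x * g') ∧ IsPalindrome S (g' * x * g) ∧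
      IsPalindrome S (g⁻¹ * x * g'⁻¹) ∧ IsPalindrome S (g'⁻¹ * x * g⁻¹) := by
  have hg : g ∈ Subgroup.closure S := hS ▸ Subgroup.mem_top g
  induction hg using Subgroup.closure_induction with
  | mem s hs =>
    have h1 : s ∈ S ∨ s⁻¹ ∈ S := Or.inl hs
    have h2 : s⁻¹ ∈ S ∨ s⁻¹⁻¹ ∈ S := Or.inr (by simpa using hs)
    exact ⟨s, rfl, fun x hx => ⟨hx.letter_mul_mul h1, hx.letter_mul_mul h1,
      hx.letter_mul_mul h2, hx.letter_mul_mul h2⟩⟩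
  | one => exact ⟨1, rfl, fun x hx => by simpa using hx⟩
  | mul g h _ _ ihg ihh =>
    obtain ⟨g', eg, hg⟩ := ihg
    obtain ⟨h', eh, hh⟩ := ihh
    refine ⟨h' * g', by rw [map_mul, map_mul, eg, eh, mul_comm], fun x hx => ⟨?_, ?_, ?_, ?_⟩⟩
    · simpa [mul_assoc] using (hg _ (hh x hx).1).1
    · simpa [mul_assoc] using (hh _ (hg x hx).2.1).2.1
    · simpa [mul_assoc] using (hh _ (hg x hx).2.2.1).2.2.1
    · simpa [mul_assoc] using (hg _ (hh x hx).2.2.2).2.2.2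
  | inv g _ ih =>
    obtain ⟨g', eg, hg⟩ := ih
    refine ⟨g'⁻¹, by rw [map_inv, map_inv, eg], fun x hx => ?_⟩
    obtain ⟨h1, h2, h3, h4⟩ := hg x hx
    simpa using ⟨h3, h4, h1, h2⟩

theorem palLength_le_of_list {S : Set G} {l : List G} (hl : ∀ p ∈ l, IsPalindrome S p) :
    palLength S l.prod ≤ l.length :=
  iInf₂_le l ⟨hl, rfl⟩

theorem exists_list_of_palLength_ne_top {S : Set G} {g : G} (h : palLength S g ≠ ⊤) :
    ∃ l : List G, (∀ p ∈ l, IsPalindrome S p) ∧ l.prod = g ∧ palLength S g = l.length := by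
  unfold palLength at h ⊢
  rw [iInf_subtype'] at h ⊢
  have hne : Nonempty {l : List G // (∀ p ∈ l, IsPalindrome S p) ∧ l.prod = g} := by
    by_contra hempty
    rw [not_nonempty_iff] at hempty
    exact h (iInf_of_empty _)
  obtain ⟨l, hl⟩ := ciInf_mem
    (fun l : {l : List G // (∀ p ∈ l, IsPalindrome S p) ∧ l.prod = g} => (l.1.length : ℕ∞))
  exact ⟨l.1, l.2.1, l.2.2, hl.symm⟩

theorem palLength_one (S : Set G) : palLength S 1 = 0 := by
  simpa using palLength_le_of_list (S := S) (l := []) (by simp)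

theorem palLength_mul_le (S : Set G) (g h : G) :
    palLength S (g * h) ≤ palLength S g + palLength S h := by
  by_cases hg : palLength S g = ⊤
  · simp [hg]
  by_cases hh : palLength S h = ⊤
  · simp [hh]
  obtain ⟨l, hl, rfl, el⟩ := exists_list_of_palLength_ne_top hg
  obtain ⟨m, hm, rfl, em⟩ := exists_list_of_palLength_ne_top hh
  rw [el, em, ← List.prod_append, ← Nat.cast_add, ← List.length_append]
  refine palLength_le_of_list fun p hp => ?_
  rcases List.mem_append.1 hp with h | h
  exacts [hl p h, hm p h]

theorem palLength_map_le {S : Set G} {T : Set H} (f : G →* H)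
    (hf : ∀ s ∈ S, f s ∈ T ∨ f s = 1) (g : G) : palLength T (f g) ≤ palLength S g := by
  by_cases hg : palLength S g = ⊤
  · simp [hg]
  obtain ⟨l, hl, rfl, el⟩ := exists_list_of_palLength_ne_top hg
  rw [el, map_list_prod]
  refine (palLength_le_of_list ?_).trans (by simp)
  simp only [List.mem_map]
  rintro _ ⟨p, hp, rfl⟩
  exact (hl p hp).map f hf

theorem palLength_le_pw (S : Set G) (g : G) : palLength S g ≤ pw S :=
  le_iSup (palLength S) g

theorem pw_le_of_surjective {S : Set G} {T : Set H} (f : G →* H)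
    (hf : ∀ s ∈ S, f s ∈ T ∨ f s = 1) (hsurj : Function.Surjective f) : pw T ≤ pw S := by
  refine iSup_le fun h => ?_
  obtain ⟨g, rfl⟩ := hsurj h
  exact (palLength_map_le f hf g).trans (palLength_le_pw S g)

/-- With `u'` the reversal of `u`, the commutator `[u, x]` is the product of the three palindromes
`u x u'`, `u'⁻¹ u⁻¹` and `x⁻¹`. -/
theorem palLength_commutator_le {S : Set G} (hS : Subgroup.closure S = ⊤) (u : G) {x : G}
    (hx : IsPalindrome S x) : palLength S ⁅u, x⁆ ≤ 3 := by
  obtain ⟨u', -, hu⟩ := exists_reversal hS u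
  have h1 := (hu x hx).1
  have h2 := (hu 1 (IsPalindrome.one S)).2.2.2
  have e : ⁅u, x⁆ = [u * x * u', u'⁻¹ * 1 * u⁻¹, x⁻¹].prod := by
    simp [commutatorElement_def, mul_assoc]
  rw [e]
  refine (palLength_le_of_list ?_).trans (by simp)
  simpa using ⟨h1, by simpa using h2, hx.inv⟩

end PalindromeLemmas

/-! ### Products of commutators with prescribed entries -/

section CommutatorProducts

variable {G : Type u} [Group G] {H : Type v} [Group H]

/-- The products `[k₁, x₁] [k₂, x₂] ⋯ [kₘ, xₘ]`, where `x₁, …, xₘ` are the entries of a fixed list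
and `k₁, …, kₘ` range over the subgroup `K`. -/
def commutatorProducts (K : Subgroup G) : List G → Set G
  | [] => {1}
  | x :: t => {g | ∃ k ∈ K, ∃ z ∈ commutatorProducts K t, g = ⁅k, x⁆ * z}

theorem one_mem_commutatorProducts (K : Subgroup G) (t : List G) :
    1 ∈ commutatorProducts K t := by
  induction t with
  | nil => rfl
  | cons x t ih => exact ⟨1, K.one_mem, 1, ih, by simp⟩

theorem commutatorProducts_append {K : Subgroup G} {s t : List G} {g h : G}
    (hg : g ∈ commutatorProducts K s) (hh : h ∈ commutatorProducts K t) :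
    g * h ∈ commutatorProducts K (s ++ t) := by
  induction s generalizing g with
  | nil =>
    obtain rfl : g = 1 := hg
    simpa using hh
  | cons x s ih =>
    obtain ⟨k, hk, z, hz, rfl⟩ := hg
    exact ⟨k, hk, z * h, ih hz, by rw [mul_assoc]⟩

theorem commutator_mem_commutatorProducts {K : Subgroup G} {t : List G} {k x : G}
    (hk : k ∈ K) (hx : x ∈ t) : ⁅k, x⁆ ∈ commutatorProducts K t := by
  induction t with
  | nil => simp at hx
  | cons y t ih =>
    rcases List.mem_cons.1 hx with rfl | hx
    · exact ⟨k, hk, 1, one_mem_commutatorProducts K t, by simp⟩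
    · exact ⟨1, K.one_mem, _, ih hx, by simp⟩

theorem map_mem_commutatorProducts (f : G →* H) {K : Subgroup G} {t : List G} {g : G}
    (hg : g ∈ commutatorProducts K t) :
    f g ∈ commutatorProducts (K.map f) (t.map f) := by
  induction t generalizing g with
  | nil =>
    obtain rfl : g = 1 := hg
    exact map_one f
  | cons x t ih =>
    obtain ⟨k, hk, z, hz, rfl⟩ := hg
    exact ⟨f k, ⟨k, hk, rfl⟩, f z, ih hz, by rw [map_mul, map_commutatorElement]⟩

theorem exists_of_mem_commutatorProducts_map (f : G →* H) {K : Subgroup G} {t : List G} {h : H}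
    (hh : h ∈ commutatorProducts (K.map f) (t.map f)) :
    ∃ g ∈ commutatorProducts K t, f g = h := by
  induction t generalizing h with
  | nil =>
    obtain rfl : h = 1 := hh
    exact ⟨1, rfl, map_one f⟩
  | cons x t ih =>
    obtain ⟨_, ⟨k, hk, rfl⟩, z, hz, rfl⟩ := hh
    obtain ⟨z, hz', rfl⟩ := ih hz
    exact ⟨⁅k, x⁆ * z, ⟨k, hk, z, hz', rfl⟩, by rw [map_mul, map_commutatorElement]⟩

/-- A factor `[d, x]` that is central can be absorbed, since then `[u d, x] = [d, x] [u, x]`. -/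
theorem mul_mem_commutatorProducts {K L : Subgroup G} (hKL : K ≤ L) {t : List G}
    (hc : ∀ k ∈ K, ∀ x ∈ t, ⁅k, x⁆ ∈ Subgroup.center G) {p q : G}
    (hp : p ∈ commutatorProducts L t) (hq : q ∈ commutatorProducts K t) :
    p * q ∈ commutatorProducts L t := by
  induction t generalizing p q with
  | nil =>
    obtain rfl : p = 1 := hp
    obtain rfl : q = 1 := hq
    simp [commutatorProducts]
  | cons x t ih =>
    obtain ⟨u, hu, z, hz, rfl⟩ := hp
    obtain ⟨d, hd, y, hy, rfl⟩ := hq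
    have hcen := Subgroup.mem_center_iff.1 (hc d hd x (by simp))
    refine ⟨u * d, L.mul_mem hu (hKL hd), z * y,
      ih (fun k hk w hw => hc k hk w (by simp [hw])) hz hy, ?_⟩
    have e : ⁅u * d, x⁆ = ⁅u, x⁆ * ⁅d, x⁆ := by
      have : ⁅u * d, x⁆ = u * ⁅d, x⁆ * u⁻¹ * ⁅u, x⁆ := by
        simp only [commutatorElement_def]; group
      rw [this, hcen u, mul_assoc _ u, mul_inv_cancel, mul_one, hcen]
    rw [e, mul_assoc, mul_assoc, ← mul_assoc z, hcen z]
    simp only [mul_assoc]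

theorem inv_mem_commutatorProducts {K : Subgroup G} {t : List G}
    (hc : ∀ k ∈ K, ∀ x ∈ t, ⁅k, x⁆ ∈ Subgroup.center G) {q : G}
    (hq : q ∈ commutatorProducts K t) : q⁻¹ ∈ commutatorProducts K t := by
  induction t generalizing q with
  | nil =>
    obtain rfl : q = 1 := hq
    simp [commutatorProducts]
  | cons x t ih =>
    obtain ⟨d, hd, y, hy, rfl⟩ := hq
    have hcen := Subgroup.mem_center_iff.1 (hc d hd x (by simp))
    refine ⟨d⁻¹, K.inv_mem hd, y⁻¹, ih (fun k hk w hw => hc k hk w (by simp [hw])) hy, ?_⟩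
    have e : ⁅d⁻¹, x⁆ = ⁅d, x⁆⁻¹ := by
      have h1 : ⁅d⁻¹, x⁆ = d⁻¹ * ⁅d, x⁆⁻¹ * d := by
        simp only [commutatorElement_def]; group
      have h2 := Subgroup.mem_center_iff.1 (inv_mem (hc d hd x (by simp))) d⁻¹
      rw [h1, h2, mul_assoc, inv_mul_cancel, mul_one]
    have h3 := Subgroup.mem_center_iff.1 (inv_mem (hc d hd x (by simp))) y⁻¹
    rw [e, mul_inv_rev, h3]

/-- When `[K, L]` is central, `[k, l]` is multiplicative in each variable. So if `L` is generated
by the list `t` together with elements that commute with `K` modulo commutators, the elements of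
`[K, L]` are the products `∏ [kᵢ, tᵢ]`. -/
theorem commutator_subset_commutatorProducts {K L C : Subgroup G} {t : List G}
    (hc : ⁅K, L⁆ ≤ Subgroup.center G) (ht : ∀ x ∈ t, x ∈ L) (hC : ⁅K, C⁆ = ⊥)
    (hL : L ≤ Subgroup.closure {x | x ∈ t} ⊔ ⁅L, L⁆ ⊔ C) {g : G} (hg : g ∈ ⁅K, L⁆) :
    g ∈ commutatorProducts K t := by
  have hc' : ∀ k ∈ K, ∀ x ∈ t, ⁅k, x⁆ ∈ Subgroup.center G := fun k hk x hx =>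
    hc (Subgroup.commutator_mem_commutator hk (ht x hx))
  let P : Subgroup G :=
    { carrier := commutatorProducts K t
      mul_mem' := fun hp hq => mul_mem_commutatorProducts le_rfl hc' hp hq
      one_mem' := one_mem_commutatorProducts K t
      inv_mem' := fun hq => inv_mem_commutatorProducts hc' hq }
  let M : Subgroup G :=
    { carrier := {h | ∀ k ∈ K, ⁅k, h⁆ ∈ P ⊓ Subgroup.center G}
      mul_mem' := by
        intro a b ha hb k hk
        have h2 := Subgroup.mem_center_iff.1 (hb k hk).2 a
        have e : ⁅k, a * b⁆ = ⁅k, a⁆ * ⁅k, b⁆ := by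
          have : ⁅k, a * b⁆ = ⁅k, a⁆ * (a * ⁅k, b⁆ * a⁻¹) := by
            simp only [commutatorElement_def]; group
          rw [this, h2, mul_assoc _ a, mul_inv_cancel, mul_one]
        rw [e]
        exact mul_mem (ha k hk) (hb k hk)
      one_mem' := fun k _ => by simp
      inv_mem' := by
        intro a ha k hk
        have h2 := Subgroup.mem_center_iff.1 (inv_mem (ha k hk).2) a⁻¹
        have e : ⁅k, a⁻¹⁆ = ⁅k, a⁆⁻¹ := by
          have : ⁅k, a⁻¹⁆ = a⁻¹ * ⁅k, a⁆⁻¹ * a := by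
            simp only [commutatorElement_def]; group
          rw [this, h2, mul_assoc, inv_mul_cancel, mul_one]
        rw [e]
        exact inv_mem (ha k hk) }
  have hLM : L ≤ M := by
    refine hL.trans (sup_le (sup_le ?_ ?_) ?_)
    · rw [Subgroup.closure_le]
      exact fun x hx k hk => ⟨commutator_mem_commutatorProducts hk hx, hc' k hk x hx⟩
    · have hcen : ⁅⁅K, L⁆, L⁆ = ⊥ := by
        rw [Subgroup.commutator_eq_bot_iff_le_centralizer]
        exact hc.trans (Subgroup.center_le_centralizer _)
      have h3 : ⁅⁅L, L⁆, K⁆ = ⊥ := Subgroup.commutator_commutator_eq_bot_of_rotate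
        (by rwa [Subgroup.commutator_comm L K]) hcen
      rw [Subgroup.commutator_comm] at h3
      intro a ha k hk
      have : ⁅k, a⁆ ∈ (⊥ : Subgroup G) := h3 ▸ Subgroup.commutator_mem_commutator hk ha
      rw [Subgroup.mem_bot.1 this]
      exact one_mem _
    · intro c hcC k hk
      have : ⁅k, c⁆ ∈ (⊥ : Subgroup G) := hC ▸ Subgroup.commutator_mem_commutator hk hcC
      rw [Subgroup.mem_bot.1 this]
      exact one_mem _
  have : ⁅K, L⁆ ≤ P := by
    rw [Subgroup.commutator_le]
    exact fun k hk l hl => (hLM hl k hk).1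
  exact this hg

/-- A product of `m` commutators `[k, x]` with palindromes `x` is a product of `3 m`
palindromes. -/
theorem palLength_le_of_mem_commutatorProducts {S : Set G}
    (hS : Subgroup.closure S = ⊤) {K : Subgroup G} {t : List G}
    (ht : ∀ x ∈ t, IsPalindrome S x) {g : G} (hg : g ∈ commutatorProducts K t) :
    palLength S g ≤ 3 * t.length := by
  induction t generalizing g with
  | nil =>
    obtain rfl : g = 1 := hg
    simp [palLength_one]
  | cons x t ih =>
    obtain ⟨k, -, z, hz, rfl⟩ := hg
    refine (palLength_mul_le _ _ _).trans ((add_le_add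
      (palLength_commutator_le hS k (ht x (by simp)))
      (ih (fun y hy => ht y (by simp [hy])) hz)).trans (le_of_eq ?_))
    rw [List.length_cons]
    push_cast
    ring

theorem Subgroup.commutator_range_map_le (f : G →* H) (N : Subgroup G) [N.Normal] :
    ⁅f.range, N.map f⁆ ≤ N.map f := by
  rw [MonoidHom.range_eq_map, ← Subgroup.map_commutator]
  exact Subgroup.map_mono (Subgroup.commutator_le_right _ _)

theorem range_le_of_top_le (f : G →* H) {N : Subgroup G}
    {t : List G} (h : ⊤ ≤ Subgroup.closure {x | x ∈ t} ⊔ ⁅(⊤ : Subgroup G), ⊤⁆ ⊔ N) :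
    f.range ≤ Subgroup.closure {x | x ∈ t.map f} ⊔ ⁅f.range, f.range⁆ ⊔ N.map f := by
  have hset : {x | x ∈ t.map f} = f '' {x | x ∈ t} := by
    ext x
    simp
  rw [hset, ← MonoidHom.map_closure, MonoidHom.range_eq_map, ← Subgroup.map_commutator,
    ← Subgroup.map_sup, ← Subgroup.map_sup]
  exact Subgroup.map_mono h

end CommutatorProducts

/-! ### Palindromic generators -/

section Generators

/-- In an abelian group, an element `x` of a generating family can be replaced by a square or by
`s y²` with `s ∈ S`, where `S` is any generating set: modulo squares the other members span a
subspace `W` of index at most two, and either `x ∈ W` or some `s ∈ S` lies in the coset `x W`. -/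
theorem exists_sq_or_mul_sq_of_sup_zpowers {M : Type*} [CommGroup M] {S : Set M}
    (hS : Subgroup.closure S = ⊤) {K : Subgroup M} {x : M}
    (hK : K ⊔ Subgroup.zpowers x = ⊤) :
    ∃ z : M, K ⊔ Subgroup.zpowers z = ⊤ ∧
      ((∃ y, z = y ^ 2) ∨ ∃ s ∈ S, ∃ y, z = s * y ^ 2) := by
  have key : ∀ k ∈ K, K ⊔ Subgroup.zpowers (x * k) = ⊤ := by
    intro k hk
    rw [eq_top_iff, ← hK, sup_le_iff, Subgroup.zpowers_le]
    refine ⟨le_sup_left, ?_⟩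
    have h1 : x * k ∈ K ⊔ Subgroup.zpowers (x * k) :=
      Subgroup.mem_sup_right (Subgroup.mem_zpowers _)
    simpa using mul_mem h1 (inv_mem (Subgroup.mem_sup_left (T := Subgroup.zpowers (x * k)) hk))
  let Q : Subgroup M := (powMonoidHom 2 : M →* M).range
  have hQ : ∀ z, z ^ 2 ∈ Q := fun z => ⟨z, rfl⟩
  by_cases hx : x ∈ K ⊔ Q
  · obtain ⟨k, hk, _, ⟨y, rfl⟩, rfl⟩ := Subgroup.mem_sup.1 hx
    exact ⟨_, key k⁻¹ (inv_mem hk), Or.inl ⟨y, by simp [mul_comm]⟩⟩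
  · obtain ⟨s, hs, hsW⟩ : ∃ s ∈ S, s ∉ K ⊔ Q := by
      by_contra! h
      have : Subgroup.closure S ≤ K ⊔ Q := (Subgroup.closure_le _).2 h
      exact hx (this (hS ▸ Subgroup.mem_top x))
    have hs' : s ∈ K ⊔ Subgroup.zpowers x := hK ▸ Subgroup.mem_top s
    obtain ⟨k, hk, _, ⟨i, rfl⟩, rfl⟩ := Subgroup.mem_sup.1 hs'
    simp only at hs hsW
    rcases Int.even_or_odd' i with ⟨j, rfl | rfl⟩
    · refine absurd ?_ hsW
      refine Subgroup.mul_mem_sup hk ?_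
      rw [mul_comm, zpow_mul]
      exact_mod_cast hQ (x ^ j)
    · refine ⟨_, key k hk, Or.inr ⟨_, hs, x ^ (-j), ?_⟩⟩
      rw [zpow_add, zpow_one, mul_comm 2 j, zpow_mul, zpow_neg]
      simp only [zpow_ofNat, inv_pow]
      rw [mul_comm x k, mul_assoc, mul_assoc, mul_comm x, mul_inv_cancel_left]

/-- An abelian group with a generating list of length `m` has a generating list of length `m` that
consists of squares and of elements `s y²` with `s ∈ S`. -/
theorem exists_list_sq_or_mul_sq {M : Type*} [CommGroup M] {S : Set M}
    (hS : Subgroup.closure S = ⊤) (t : List M) (K : Subgroup M)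
    (hK : K ⊔ Subgroup.closure {x | x ∈ t} = ⊤) :
    ∃ t' : List M, t'.length = t.length ∧ K ⊔ Subgroup.closure {x | x ∈ t'} = ⊤ ∧
      ∀ z ∈ t', (∃ y, z = y ^ 2) ∨ ∃ s ∈ S, ∃ y, z = s * y ^ 2 := by
  have hcons : ∀ (x : M) (r : List M), Subgroup.closure {y | y ∈ x :: r} =
      Subgroup.zpowers x ⊔ Subgroup.closure {y | y ∈ r} := by
    intro x r
    rw [Subgroup.zpowers_eq_closure, ← Subgroup.closure_union]
    congr 1
    ext y
    simp
  induction t generalizing K with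
  | nil => exact ⟨[], rfl, hK, by simp⟩
  | cons x r ih =>
    rw [hcons, sup_comm (Subgroup.zpowers x), ← sup_assoc] at hK
    obtain ⟨z, hz, hz'⟩ := exists_sq_or_mul_sq_of_sup_zpowers hS hK
    rw [sup_assoc, sup_comm (Subgroup.closure _), ← sup_assoc] at hz
    obtain ⟨t', hlen, ht', hgood⟩ := ih _ hz
    refine ⟨z :: t', by simp [hlen], by rw [hcons, ← sup_assoc, ht'], ?_⟩
    intro w hw
    rcases List.mem_cons.1 hw with rfl | hw
    exacts [hz', hgood w hw]

variable {G : Type u} [Group G]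

/-- If `G ⧸ N` has a generating set of finite cardinality `m`, then `m` palindromes generate `G`
modulo `N` and commutators: modulo commutators, `y²` and `s y²` are the images of the palindromes
`y y'` and `y s y'`, where `y'` is a reversal of `y`. -/
theorem exists_palindromes_generating {S : Set G} (hS : Subgroup.closure S = ⊤)
    (N : Subgroup G) [N.Normal] (S' : Set (G ⧸ N)) (hfin : S'.Finite)
    (hS' : Subgroup.closure S' = ⊤) :
    ∃ t : List G, (t.length : ℕ∞) = S'.encard ∧ (∀ x ∈ t, IsPalindrome S x) ∧
      ⊤ ≤ Subgroup.closure {x | x ∈ t} ⊔ ⁅(⊤ : Subgroup G), ⊤⁆ ⊔ N := by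
  let π : G →* Abelianization (G ⧸ N) := Abelianization.of.comp (QuotientGroup.mk' N)
  have hof : Function.Surjective (Abelianization.of : G ⧸ N →* Abelianization (G ⧸ N)) :=
    QuotientGroup.mk_surjective
  have hπ : Function.Surjective π := hof.comp (QuotientGroup.mk'_surjective N)
  have hπS : Subgroup.closure (π '' S) = ⊤ := by
    rw [← MonoidHom.map_closure, hS, Subgroup.map_top_of_surjective π hπ]
  let t₀ : List (Abelianization (G ⧸ N)) := hfin.toFinset.toList.map Abelianization.of
  have ht₀ : (⊥ : Subgroup (Abelianization (G ⧸ N))) ⊔ Subgroup.closure {x | x ∈ t₀} = ⊤ := by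
    have : {x | x ∈ t₀} = Abelianization.of '' S' := by
      ext x
      simp [t₀]
    rw [bot_sup_eq, this, ← MonoidHom.map_closure, hS', Subgroup.map_top_of_surjective _ hof]
  obtain ⟨t', hlen, ht', hgood⟩ := exists_list_sq_or_mul_sq hπS t₀ ⊥ ht₀
  rw [bot_sup_eq] at ht'
  have hlift : ∀ z ∈ t', ∃ p : G, IsPalindrome S p ∧ π p = z := by
    have hrev : ∀ y y' : G, Abelianization.of y' = Abelianization.of y → π y' = π y := by
      intro y y' h
      have := congrArg (Abelianization.lift π) h
      simpa using this
    intro z hz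
    rcases hgood z hz with ⟨y, rfl⟩ | ⟨_, ⟨s, hs, rfl⟩, y, rfl⟩
    · obtain ⟨y, rfl⟩ := hπ y
      obtain ⟨y', e, h⟩ := exists_reversal hS y
      refine ⟨y * 1 * y', (h 1 (IsPalindrome.one S)).1, ?_⟩
      rw [mul_one, map_mul, hrev _ _ e, sq]
    · obtain ⟨y, rfl⟩ := hπ y
      obtain ⟨y', e, h⟩ := exists_reversal hS y
      refine ⟨y * s * y', (h s (IsPalindrome.of_mem hs)).1, ?_⟩
      rw [map_mul, map_mul, hrev _ _ e, sq, mul_comm (π y), mul_assoc]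
  choose! p hp hpz using hlift
  refine ⟨t'.map p, ?_, ?_, ?_⟩
  · rw [List.length_map, hlen, List.length_map, Finset.length_toList,
      ← Set.encard_coe_eq_coe_finsetCard, hfin.coe_toFinset]
  · intro x hx
    obtain ⟨z, hz, rfl⟩ := List.mem_map.1 hx
    exact hp z hz
  · have hker : π.ker ≤ ⁅(⊤ : Subgroup G), ⊤⁆ ⊔ N := by
      intro g hg
      have h1 : QuotientGroup.mk' N g ∈ commutator (G ⧸ N) := by
        rw [← Abelianization.ker_of]
        exact hg
      rw [commutator_def, ← Subgroup.map_top_of_surjective _ (QuotientGroup.mk'_surjective N),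
        ← Subgroup.map_commutator] at h1
      have h2 : g ∈ (Subgroup.map (QuotientGroup.mk' N) ⁅(⊤ : Subgroup G), ⊤⁆).comap
        (QuotientGroup.mk' N) := h1
      rwa [Subgroup.comap_map_eq, QuotientGroup.ker_mk'] at h2
    have hmap : (Subgroup.closure {x | x ∈ t'.map p}).map π = ⊤ := by
      have : π '' {x | x ∈ t'.map p} = {x | x ∈ t'} := by
        ext x
        simp only [List.mem_map, Set.mem_image, Set.mem_ofPred_eq]
        constructor
        · rintro ⟨_, ⟨z, hz, rfl⟩, rfl⟩
          rwa [hpz z hz]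
        · exact fun hx => ⟨_, ⟨x, hx, rfl⟩, hpz x hx⟩
      rw [MonoidHom.map_closure, this, ht']
    rw [sup_assoc]
    refine le_trans ?_ (sup_le_sup_left hker _)
    rw [← Subgroup.comap_map_eq, hmap, Subgroup.comap_top]

end Generators

/-! ### Approximation along the series of a normal subgroup -/

section CommutatorSeries

variable {G : Type u} [Group G]

/-- The series `D, [D, G], [[D, G], G], …`. -/
def commutatorSeries (D : Subgroup G) : ℕ → Subgroup G
  | 0 => D
  | k + 1 => ⁅commutatorSeries D k, (⊤ : Subgroup G)⁆

theorem commutatorSeries_normal (D : Subgroup G) [hD : D.Normal] (k : ℕ) :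
    (commutatorSeries D k).Normal := by
  induction k with
  | zero => exact hD
  | succ k ih => exact Subgroup.commutator_normal _ _

theorem commutatorSeries_le (D : Subgroup G) [D.Normal] (k : ℕ) : commutatorSeries D k ≤ D := by
  induction k with
  | zero => exact le_rfl
  | succ k ih =>
    have := commutatorSeries_normal D k
    exact (Subgroup.commutator_le_left _ _).trans ih

theorem commutatorSeries_le_lowerCentralSeries {D : Subgroup G}
    (hD : D ≤ ⁅(⊤ : Subgroup G), ⊤⁆) (k : ℕ) :
    commutatorSeries D k ≤ (⊤ : Subgroup G).lowerCentralSeries (k + 1) := by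
  induction k with
  | zero => exact hD
  | succ k ih => exact Subgroup.commutator_mono ih le_rfl

theorem map_commutatorSeries {H : Type v} [Group H] (f : G →* H) (hf : Function.Surjective f)
    (D : Subgroup G) (k : ℕ) :
    (commutatorSeries D k).map f = commutatorSeries (D.map f) k := by
  induction k with
  | zero => rfl
  | succ k ih =>
    rw [commutatorSeries, Subgroup.map_commutator, ih, Subgroup.map_top_of_surjective f hf]
    rfl

/-- Modulo a normal subgroup `N` in which `[[K, L], G]` lies, a product of commutators with the
entries of `t`, multiplied by an element of `[K, L]`, is again such a product: by
`commutator_subset_commutatorProducts` in `G ⧸ N`, that element is a product of central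
commutators, which are absorbed by `mul_mem_commutatorProducts`. -/
theorem exists_mul_of_commutator_le {K L C N : Subgroup G} [N.Normal] {t : List G}
    (hc : ⁅⁅K, L⁆, (⊤ : Subgroup G)⁆ ≤ N) (ht : ∀ x ∈ t, x ∈ L) (hC : ⁅K, C⁆ = ⊥)
    (hL : L ≤ Subgroup.closure {x | x ∈ t} ⊔ ⁅L, L⁆ ⊔ C) {p g : G}
    (hp : p ∈ commutatorProducts ⊤ t) (hg : g ∈ ⁅K, L⁆) :
    ∃ q ∈ commutatorProducts ⊤ t, q⁻¹ * (p * g) ∈ N := by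
  let f := QuotientGroup.mk' N
  have hf : Function.Surjective f := QuotientGroup.mk'_surjective N
  have hc' : ⁅K.map f, L.map f⁆ ≤ Subgroup.center (G ⧸ N) := by
    rw [← Subgroup.centralizer_univ, ← Subgroup.coe_top,
      ← Subgroup.commutator_eq_bot_iff_le_centralizer,
      ← Subgroup.map_commutator, ← Subgroup.map_top_of_surjective f hf, ← Subgroup.map_commutator,
      Subgroup.map_eq_bot_iff, QuotientGroup.ker_mk']
    exact hc
  have ht' : ∀ x ∈ t.map f, x ∈ L.map f := by
    simp only [List.mem_map]
    rintro _ ⟨x, hx, rfl⟩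
    exact ⟨x, ht x hx, rfl⟩
  have hset : {x | x ∈ t.map f} = f '' {x | x ∈ t} := by
    ext x
    simp
  have hgq : f g ∈ commutatorProducts (K.map f) (t.map f) := by
    refine commutator_subset_commutatorProducts (C := C.map f) (L := L.map f) hc' ht' ?_ ?_ ?_
    · rw [← Subgroup.map_commutator, hC, Subgroup.map_bot]
    · rw [hset, ← MonoidHom.map_closure, ← Subgroup.map_commutator, ← Subgroup.map_sup,
        ← Subgroup.map_sup]
      exact Subgroup.map_mono hL
    · rw [← Subgroup.map_commutator]
      exact ⟨g, hg, rfl⟩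
  have hpq := mul_mem_commutatorProducts (L := (⊤ : Subgroup G).map f) (Subgroup.map_mono le_top)
    (fun k hk x hx => hc' (Subgroup.commutator_mem_commutator hk (ht' x hx)))
    (map_mem_commutatorProducts f hp) hgq
  obtain ⟨q, hq, e⟩ := exists_of_mem_commutatorProducts_map f hpq
  refine ⟨q, hq, ?_⟩
  rw [← map_mul] at e
  exact QuotientGroup.eq.1 e

/-- If `U` and `V` generate `G`, if `s` (resp. `t`) generates `U` (resp. `V`) modulo commutators
and modulo a subgroup centralizing `V` and `[U, V]` (resp. `U` and `[U, V]`), and if `[U, V]` lies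
in a term of the upper central series, then each element of `[U, V]` is a product of commutators
`[g, x]`, one for each entry `x` of `s` and `t`. This is proved by successive approximation along
the series `D = [U, V], [D, G], [[D, G], G], …`. -/
theorem mem_commutatorProducts_of_commutatorSeries_eq_bot {U V C E : Subgroup G} {s t : List G}
    [hD : ⁅U, V⁆.Normal] (hUV : U ⊔ V = ⊤) (hs : ∀ x ∈ s, x ∈ U)
    (hsU : U ≤ Subgroup.closure {x | x ∈ s} ⊔ ⁅U, U⁆ ⊔ C)
    (htV : V ≤ Subgroup.closure {x | x ∈ t} ⊔ ⁅V, V⁆ ⊔ E)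
    (hCV : ⁅V, C⁆ = ⊥) (hC : ⁅⁅U, V⁆, C⁆ = ⊥) (hE : ⁅⁅U, V⁆, E⁆ = ⊥) {n : ℕ}
    (hn : commutatorSeries ⁅U, V⁆ n = ⊥) {c : G} (hc : c ∈ ⁅U, V⁆) :
    c ∈ commutatorProducts ⊤ (s ++ t) := by
  have hnormal := commutatorSeries_normal ⁅U, V⁆
  have htop : (⊤ : Subgroup G) ≤ Subgroup.closure {x | x ∈ s ++ t} ⊔ ⁅(⊤ : Subgroup G), ⊤⁆ ⊔
      (C ⊔ E) := by
    rw [← hUV]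
    refine sup_le (hsU.trans ?_) (htV.trans ?_)
    · refine sup_le_sup (sup_le_sup (Subgroup.closure_mono ?_) ?_) le_sup_left
      · exact fun x hx => List.mem_append_left _ hx
      · exact Subgroup.commutator_mono le_sup_left le_sup_left
    · refine sup_le_sup (sup_le_sup (Subgroup.closure_mono ?_) ?_) le_sup_right
      · exact fun x hx => List.mem_append_right _ hx
      · exact Subgroup.commutator_mono le_sup_right le_sup_right
  have hDCE : ⁅⁅U, V⁆, C ⊔ E⁆ = ⊥ := by
    rw [Subgroup.commutator_comm, Subgroup.commutator_eq_bot_iff_le_centralizer]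
    rw [Subgroup.commutator_comm, Subgroup.commutator_eq_bot_iff_le_centralizer] at hC hE
    exact sup_le hC hE
  have happrox : ∀ k, ∃ p ∈ commutatorProducts ⊤ (s ++ t),
      p⁻¹ * c ∈ commutatorSeries ⁅U, V⁆ k := by
    intro k
    induction k with
    | zero => exact ⟨1, one_mem_commutatorProducts _ _, by rwa [inv_one, one_mul]⟩
    | succ k ih =>
      cases k with
      | zero =>
        have := hnormal 1
        rw [Subgroup.commutator_comm] at hc
        obtain ⟨q, hq, hqN⟩ := exists_mul_of_commutator_le (K := V) (L := U) (C := C)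
          (N := commutatorSeries ⁅U, V⁆ 1) (by rw [Subgroup.commutator_comm V U]; exact le_rfl)
          hs hCV hsU (one_mem_commutatorProducts ⊤ s) hc
        refine ⟨q, ?_, by simpa using hqN⟩
        simpa using commutatorProducts_append hq (one_mem_commutatorProducts ⊤ t)
      | succ k =>
        obtain ⟨p, hp, hpk⟩ := ih
        have := hnormal (k + 2)
        obtain ⟨q, hq, hqN⟩ := exists_mul_of_commutator_le (K := commutatorSeries ⁅U, V⁆ k)
          (L := ⊤) (C := C ⊔ E) (N := commutatorSeries ⁅U, V⁆ (k + 2)) le_rfl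
          (fun x _ => Subgroup.mem_top x)
          (le_bot_iff.1 ((Subgroup.commutator_mono (commutatorSeries_le _ k) le_rfl).trans
            hDCE.le)) htop hp hpk
        exact ⟨q, hq, by simpa using hqN⟩
  obtain ⟨p, hp, h⟩ := happrox n
  rw [hn, Subgroup.mem_bot, inv_mul_eq_one] at h
  exact h ▸ hp

end CommutatorSeries

/-! ### The nilpotent product -/

namespace NilpotentProduct

variable (A : Type u) (B : Type v) [Group A] [Group B] (n : ℕ)

theorem range_inl_sup_range_inr : (inl A B n).range ⊔ (inr A B n).range = ⊤ := by
  rw [inl, inr, MonoidHom.range_comp, MonoidHom.range_comp, ← Subgroup.map_sup,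
    Monoid.Coprod.range_inl_sup_range_inr,
    Subgroup.map_top_of_surjective _ (QuotientGroup.mk'_surjective _)]

theorem map_cartesianSubgroup :
    (cartesianSubgroup A B).map (QuotientGroup.mk' (nilpotentProductKernel A B n)) =
      ⁅(inl A B n).range, (inr A B n).range⁆ := by
  rw [cartesianSubgroup, Subgroup.map_commutator, inl, inr, MonoidHom.range_comp,
    MonoidHom.range_comp]

instance commutator_range_normal : ⁅(inl A B n).range, (inr A B n).range⁆.Normal := by
  rw [← map_cartesianSubgroup]
  exact (cartesianSubgroup_normal A B).map _ (QuotientGroup.mk'_surjective _)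

/-- Dividing out `[A, B] ∩ γₙ₊₁(A ∗ B)` makes the series of `[A, B]` trivial after `n - 1` steps,
because its `k`-th term lies in `[A, B] ∩ γₖ₊₂(A ∗ B)`. -/
theorem commutatorSeries_eq_bot {n : ℕ} (hn : 1 ≤ n) :
    commutatorSeries ⁅(inl A B n).range, (inr A B n).range⁆ (n - 1) = ⊥ := by
  rw [← map_cartesianSubgroup, ← map_commutatorSeries _ (QuotientGroup.mk'_surjective _),
    Subgroup.map_eq_bot_iff, QuotientGroup.ker_mk']
  refine le_inf (commutatorSeries_le _ _) ?_
  have h := commutatorSeries_le_lowerCentralSeries (D := cartesianSubgroup A B)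
    (Subgroup.commutator_mono le_top le_top) (n - 1)
  rwa [Nat.sub_add_cancel hn] at h

/-- Every element of `A(n)B` is of the form `a b c` with `a ∈ A`, `b ∈ B` and `c ∈ [A, B]`. -/
theorem exists_eq_inl_mul_inr_mul (g : NilpotentProduct A B n) :
    ∃ (a : A) (b : B), ∃ c ∈ ⁅(inl A B n).range, (inr A B n).range⁆,
      g = inl A B n a * inr A B n b * c := by
  have hg : g ∈ (inl A B n).range ⊔ (inr A B n).range :=
    range_inl_sup_range_inr A B n ▸ Subgroup.mem_top g
  rw [Subgroup.sup_eq_closure] at hg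
  induction hg using Subgroup.closure_induction_left with
  | one => exact ⟨1, 1, 1, one_mem _, by simp⟩
  | mul_left x hx y _ ih =>
    obtain ⟨a, b, c, hc, rfl⟩ := ih
    rcases hx with ⟨a', rfl⟩ | ⟨b', rfl⟩
    · exact ⟨a' * a, b, c, hc, by simp only [map_mul, mul_assoc]⟩
    · refine ⟨a, b' * b, (inr A B n b)⁻¹ * ⁅inr A B n b'⁻¹, inl A B n a⁻¹⁆ * (inr A B n b)⁻¹⁻¹ * c,
        mul_mem ((commutator_range_normal A B n).conj_mem _ ?_ _) hc, ?_⟩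
      · rw [Subgroup.commutator_comm]
        exact Subgroup.commutator_mem_commutator ⟨_, rfl⟩ ⟨_, rfl⟩
      · simp only [map_mul, map_inv, commutatorElement_def]
        group
  | inv_mul_cancel x hx y _ ih =>
    obtain ⟨a, b, c, hc, rfl⟩ := ih
    rcases hx with ⟨a', rfl⟩ | ⟨b', rfl⟩
    · exact ⟨a'⁻¹ * a, b, c, hc, by simp only [map_mul, map_inv, mul_assoc]⟩
    · refine ⟨a, b'⁻¹ * b, (inr A B n b)⁻¹ * ⁅inr A B n b', inl A B n a⁻¹⁆ * (inr A B n b)⁻¹⁻¹ * c,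
        mul_mem ((commutator_range_normal A B n).conj_mem _ ?_ _) hc, ?_⟩
      · rw [Subgroup.commutator_comm]
        exact Subgroup.commutator_mem_commutator ⟨_, rfl⟩ ⟨_, rfl⟩
      · simp only [map_mul, map_inv, commutatorElement_def]
        group

theorem toProd_inl (a : A) : toProd A B n (inl A B n a) = (a, 1) :=
  Monoid.Coprod.toProd_apply_inl a

theorem toProd_inr (b : B) : toProd A B n (inr A B n b) = (1, b) :=
  Monoid.Coprod.toProd_apply_inr b

theorem closure_generators {X : Set A} {Y : Set B} (hX : Subgroup.closure X = ⊤)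
    (hY : Subgroup.closure Y = ⊤) :
    Subgroup.closure (inl A B n '' X ∪ inr A B n '' Y) = ⊤ := by
  rw [Subgroup.closure_union, ← MonoidHom.map_closure, ← MonoidHom.map_closure, hX, hY,
    ← MonoidHom.range_eq_map, ← MonoidHom.range_eq_map, range_inl_sup_range_inr]

theorem commutator_range_inr_map_centralizerLeft :
    ⁅(inr A B n).range, (centralizerLeft A B n).map (inl A B n)⁆ = ⊥ := by
  rw [Subgroup.commutator_comm, Subgroup.commutator_eq_bot_iff_le_centralizer]
  exact Subgroup.map_comap_le _ _

theorem commutator_range_inl_map_centralizerRight :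
    ⁅(inl A B n).range, (centralizerRight A B n).map (inr A B n)⁆ = ⊥ := by
  rw [Subgroup.commutator_comm, Subgroup.commutator_eq_bot_iff_le_centralizer]
  exact Subgroup.map_comap_le _ _

/-- `C_A(B)` centralizes `[A, B]`, by the three subgroups lemma and the normality of `C_A(B)`. -/
theorem commutator_commutator_map_centralizerLeft :
    ⁅⁅(inl A B n).range, (inr A B n).range⁆, (centralizerLeft A B n).map (inl A B n)⁆ = ⊥ := by
  have h := commutator_range_inr_map_centralizerLeft A B n
  refine Subgroup.commutator_commutator_eq_bot_of_rotate ?_ ?_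
  · rw [h, Subgroup.commutator_bot_left]
  · rw [eq_bot_iff, ← h, Subgroup.commutator_comm _ (inl A B n).range,
      Subgroup.commutator_comm (inr A B n).range]
    exact Subgroup.commutator_mono (Subgroup.commutator_range_map_le _ _) le_rfl

theorem commutator_commutator_map_centralizerRight :
    ⁅⁅(inl A B n).range, (inr A B n).range⁆, (centralizerRight A B n).map (inr A B n)⁆ = ⊥ := by
  have h := commutator_range_inl_map_centralizerRight A B n
  refine Subgroup.commutator_commutator_eq_bot_of_rotate ?_ ?_
  · rw [eq_bot_iff, ← h, Subgroup.commutator_comm (inl A B n).range]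
    exact Subgroup.commutator_mono (Subgroup.commutator_range_map_le _ _) le_rfl
  · rw [Subgroup.commutator_comm _ (inl A B n).range, h, Subgroup.commutator_bot_left]

variable {A B n}

theorem inl_mem_generators (X : Set A) (Y : Set B) (x : A) (hx : x ∈ X) :
    inl A B n x ∈ inl A B n '' X ∪ inr A B n '' Y ∨ inl A B n x = 1 :=
  Or.inl (Or.inl ⟨x, hx, rfl⟩)

theorem inr_mem_generators (X : Set A) (Y : Set B) (y : B) (hy : y ∈ Y) :
    inr A B n y ∈ inl A B n '' X ∪ inr A B n '' Y ∨ inr A B n y = 1 :=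
  Or.inl (Or.inr ⟨y, hy, rfl⟩)

/-- The homomorphisms from `A(n)B` onto `A` and onto `B` send each generator to a generator or to
`1`, so they do not increase palindromic lengths. -/
theorem max_pw_le_pw (X : Set A) (Y : Set B) :
    max (pw X) (pw Y) ≤ pw (inl A B n '' X ∪ inr A B n '' Y) := by
  refine max_le ?_ ?_
  · refine pw_le_of_surjective ((MonoidHom.fst A B).comp (toProd A B n)) ?_ fun a =>
      ⟨inl A B n a, by simp [toProd_inl]⟩
    rintro _ (⟨x, hx, rfl⟩ | ⟨y, -, rfl⟩)
    · exact Or.inl (by simpa [toProd_inl] using hx)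
    · exact Or.inr (by simp [toProd_inr])
  · refine pw_le_of_surjective ((MonoidHom.snd A B).comp (toProd A B n)) ?_ fun b =>
      ⟨inr A B n b, by simp [toProd_inr]⟩
    rintro _ (⟨x, -, rfl⟩ | ⟨y, hy, rfl⟩)
    · exact Or.inr (by simp [toProd_inl])
    · exact Or.inl (by simpa [toProd_inr] using hy)

/-- In the decomposition `g = a b c`, the factors `a` and `b` cost at most `pw X` and `pw Y`
palindromes. -/
theorem pw_le_add {X : Set A} {Y : Set B} {m : ℕ∞}
    (h : ∀ c ∈ ⁅(inl A B n).range, (inr A B n).range⁆,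
      palLength (inl A B n '' X ∪ inr A B n '' Y) c ≤ m) :
    pw (inl A B n '' X ∪ inr A B n '' Y) ≤ pw X + pw Y + m := by
  refine iSup_le fun g => ?_
  obtain ⟨a, b, c, hc, rfl⟩ := exists_eq_inl_mul_inr_mul A B n g
  refine (palLength_mul_le _ _ _).trans (add_le_add ?_ (h c hc))
  refine (palLength_mul_le _ _ _).trans (add_le_add ?_ ?_)
  · exact (palLength_map_le _ (inl_mem_generators X Y) a).trans (palLength_le_pw X a)
  · exact (palLength_map_le _ (inr_mem_generators X Y) b).trans (palLength_le_pw Y b)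

theorem commutator_range_eq_bot
    (h : centralizerLeft A B n = ⊤ ∨ centralizerRight A B n = ⊤) :
    ⁅(inl A B n).range, (inr A B n).range⁆ = ⊥ := by
  rcases h with h | h
  · have := commutator_range_inr_map_centralizerLeft A B n
    rwa [h, ← MonoidHom.range_eq_map, Subgroup.commutator_comm] at this
  · have := commutator_range_inl_map_centralizerRight A B n
    rwa [h, ← MonoidHom.range_eq_map] at this

theorem toProd_bijective (h : ⁅(inl A B n).range, (inr A B n).range⁆ = ⊥) :
    Function.Bijective (toProd A B n) := by
  refine ⟨(injective_iff_map_eq_one _).2 fun g hg => ?_, fun p => ?_⟩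
  · obtain ⟨a, b, c, hc, rfl⟩ := exists_eq_inl_mul_inr_mul A B n g
    rw [h, Subgroup.mem_bot] at hc
    subst hc
    have : a = 1 ∧ b = 1 := by simpa [toProd_inl, toProd_inr] using hg
    simp [this.1, this.2]
  · exact ⟨inl A B n p.1 * inr A B n p.2, by simp [toProd_inl, toProd_inr]⟩

/-- Each element of `[A, B]` is a product of `m_A + m_B` commutators with palindromes, so its
palindromic length is at most `3 (m_A + m_B)`. -/
theorem palLength_commutator_range_le {X : Set A} {Y : Set B} (hX : Subgroup.closure X = ⊤)
    (hY : Subgroup.closure Y = ⊤) (hn : 1 ≤ n) {X' : Set (A ⧸ centralizerLeft A B n)}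
    {Y' : Set (B ⧸ centralizerRight A B n)} (hX' : Subgroup.closure X' = ⊤)
    (hY' : Subgroup.closure Y' = ⊤) {c : NilpotentProduct A B n}
    (hc : c ∈ ⁅(inl A B n).range, (inr A B n).range⁆) :
    palLength (inl A B n '' X ∪ inr A B n '' Y) c ≤ 3 * (X'.encard + Y'.encard) := by
  by_cases hfX : X'.Finite
  swap
  · simp [Set.Infinite.encard_eq hfX]
  by_cases hfY : Y'.Finite
  swap
  · simp [Set.Infinite.encard_eq hfY]
  obtain ⟨s, hs, hsp, hsg⟩ := exists_palindromes_generating hX _ X' hfX hX'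
  obtain ⟨t, ht, htp, htg⟩ := exists_palindromes_generating hY _ Y' hfY hY'
  have hmem := mem_commutatorProducts_of_commutatorSeries_eq_bot
    (s := s.map (inl A B n)) (t := t.map (inr A B n))
    (range_inl_sup_range_inr A B n) (by
      simp only [List.mem_map]
      rintro _ ⟨x, -, rfl⟩
      exact ⟨x, rfl⟩)
    (range_le_of_top_le _ hsg) (range_le_of_top_le _ htg)
    (commutator_range_inr_map_centralizerLeft A B n)
    (commutator_commutator_map_centralizerLeft A B n)
    (commutator_commutator_map_centralizerRight A B n) (commutatorSeries_eq_bot A B hn) hc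
  refine (palLength_le_of_mem_commutatorProducts (closure_generators A B n hX hY) ?_ hmem).trans
    (le_of_eq ?_)
  · intro x hx
    rcases List.mem_append.1 hx with hx | hx <;> obtain ⟨y, hy, rfl⟩ := List.mem_map.1 hx
    · exact (hsp y hy).map _ (inl_mem_generators X Y)
    · exact (htp y hy).map _ (inr_mem_generators X Y)
  · rw [← hs, ← ht]
    simp

end NilpotentProduct

theorem theorem3p2 {A : Type u} {B : Type v} [Group A] [Group B] [Group.FG A] [Group.FG B]
    (X : Set A) (hX : Subgroup.closure X = ⊤) (Y : Set B) (hY : Subgroup.closure Y = ⊤)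
    (n : ℕ) (hn : 1 ≤ n) :
    (max (pw X) (pw Y) ≤
        pw (NilpotentProduct.inl A B n '' X ∪ NilpotentProduct.inr A B n '' Y) ∧
      ∀ (X' : Set (A ⧸ NilpotentProduct.centralizerLeft A B n))
        (Y' : Set (B ⧸ NilpotentProduct.centralizerRight A B n)),
        Subgroup.closure X' = ⊤ → Subgroup.closure Y' = ⊤ →
        pw (NilpotentProduct.inl A B n '' X ∪ NilpotentProduct.inr A B n '' Y) ≤
          pw X + pw Y + 3 * (X'.encard + Y'.encard)) ∧
    (NilpotentProduct.centralizerLeft A B n = ⊤ ∨ NilpotentProduct.centralizerRight A B n = ⊤ →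
      Function.Bijective (NilpotentProduct.toProd A B n) ∧
      max (pw X) (pw Y) ≤
        pw (NilpotentProduct.inl A B n '' X ∪ NilpotentProduct.inr A B n '' Y) ∧
      pw (NilpotentProduct.inl A B n '' X ∪ NilpotentProduct.inr A B n '' Y) ≤
        pw X + pw Y) := by
  refine ⟨⟨NilpotentProduct.max_pw_le_pw X Y, fun X' Y' hX' hY' =>
    NilpotentProduct.pw_le_add fun c hc =>
      NilpotentProduct.palLength_commutator_range_le hX hY hn hX' hY' hc⟩, fun h => ?_⟩
  have hbot := NilpotentProduct.commutator_range_eq_bot h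
  refine ⟨NilpotentProduct.toProd_bijective hbot, NilpotentProduct.max_pw_le_pw X Y, ?_⟩
  rw [← add_zero (pw X + pw Y)]
  refine NilpotentProduct.pw_le_add fun c hc => ?_
  rw [hbot, Subgroup.mem_bot] at hc
  rw [hc, palLength_one]
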